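/- Place $n+1$ points ($n\ge 0$) on a circle. A rooted generalized non-crossing tree (GNC-tree) on these points consists of a tree whose vertices are the points and whose edges are straight chords that do not cross, one point chosen as root, and a labelling of the points by positive integers such that, in counterclockwise order starting at the root, the labels are weakly increasing, and whenever $j$ is a label, every integer $i$ with $1\le i\le j$ is also a label (so the root is the first point with label $1$). Two GNC-trees are identified if they agree when their points are numbered $0,1,\dots,n$ counterclockwise from the root. A level of a GNC-tree is an edge whose two endpoints have the same label. A GNC-tree is $h$-avoiding if it has no level, i.e. if no path starting at the root uses a level edge. Theorem. For every $n\ge 0$ the set of $h$-avoiding rooted GNC-trees on $n+1$ points is finite, and its cardinality is $$\sum_{i=0}^{n}(-1)^{n-i}\,\frac{2^i}{2i+1}\binom{3i}{i}\binom{n+2i}{3i}.$$ -/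

import Mathlib

/-- A graph on the points `0, 1, …, n`, placed on a circle in counterclockwise order and with edges
drawn as chords, is non-crossing: no two chords meet in the interior of the circle other than at
their end points, i.e. there are no edges `{a, c}` and `{b, d}` with `a < b < c < d`. -/
def NonCrossing {n : ℕ} (G : SimpleGraph (Fin (n + 1))) : Prop :=
  ∀ a b c d : Fin (n + 1), a < b → b < c → c < d → G.Adj a c → ¬ G.Adj b d

/-- A rooted generalized non-crossing tree on `n + 1` points. The points are `0, 1, …, n` in
counterclockwise order, starting from the root `0`, which is the first point with label `1`.
The labels are positive integers, weakly increasing in counterclockwise order, and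
together with a label `j` all the integers `1 ≤ i ≤ j` are labels too. -/
@[ext]
structure GNCTree (n : ℕ) where
  /-- the underlying tree -/
  graph : SimpleGraph (Fin (n + 1))
  isTree : graph.IsTree
  nonCrossing : NonCrossing graph
  /-- the label of each point -/
  label : Fin (n + 1) → ℕ
  one_le_label : ∀ v, 1 ≤ label v
  label_mono : Monotone label
  label_initial : ∀ v i, 1 ≤ i → i ≤ label v → ∃ w, label w = i

/-- The three kinds of edges, read away from the root: ascents `u`, levels `h`, descents `d`. -/
inductive EdgeKind where
  | u
  | h
  | d

namespace GNCTree

variable {n : ℕ}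

/-- The letter of an edge from `v` to `w`, where `v` is the end closer to the root:
an ascent if the label increases, a level if it stays equal, a descent if it decreases. -/
def edgeKind (T : GNCTree n) (v w : Fin (n + 1)) : EdgeKind :=
  if T.label v < T.label w then EdgeKind.u
  else if T.label v = T.label w then EdgeKind.h
  else EdgeKind.d

/-- The word on `{u, h, d}` encoding a walk in the tree. -/
def word (T : GNCTree n) {v w : Fin (n + 1)} (p : T.graph.Walk v w) : List EdgeKind :=
  p.darts.map fun e => T.edgeKind e.fst e.snd

/-- `T` contains the pattern `σ` if `σ` occurs, in consecutive positions, in the word of some path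
of `T` that starts at the root. -/
def Contains (T : GNCTree n) (σ : List EdgeKind) : Prop :=
  ∃ (v : Fin (n + 1)) (p : T.graph.Walk 0 v), p.IsPath ∧ σ <:+: T.word p

/-- `T` is `σ`-avoiding. -/
def Avoids (T : GNCTree n) (σ : List EdgeKind) : Prop :=
  ¬ T.Contains σ

/-- The set of rooted GNC-trees on `n + 1` points which avoid all the patterns in `P`. -/
def avoiding (n : ℕ) (P : Set (List EdgeKind)) : Set (GNCTree n) :=
  {T | ∀ σ ∈ P, T.Avoids σ}

end GNCTree

/-! By `mem_avoiding_h_iff` and `label_eq`, an h-avoiding GNC-tree is a non-crossing tree on `0, …,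
n` together with the set `L` of gaps where the label rises, such that every edge spans a gap of `L`.
On points `a, …, b` with `a < b`, let `m` be the largest neighbour of `a`. Removing the edge `am`
leaves non-crossing trees on `[a, k]`, `[k + 1, m]` and `[m, b]` for a unique `k` (`exists_glue`,
`glue_inj`). The gaps of `L` other than `k` are shared out among these pieces, so the whole
structure is a ternary tree whose nodes record whether `k ∈ L`. An edge in one of the first two
pieces already provides a gap below `am`; hence the only forbidden nodes have `k ∉ L` and single
points as their first two pieces.

So the generating function satisfies `F = 1 + 2XF³ - XF`, the last term removing the forbidden nodes
(`cubic_goodFinset`). Then `(1 + X)F = B(X / (1 + X)³)` with `B = 1 + 2XB³`. The coefficients of `B`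
follow from a linear differential equation, and expanding in powers of `X` gives the sum
(`coeff_of_cubic_sub`). -/

/-! ### Power series: the cubic equation and its coefficients. -/

namespace PowerSeries

/-- A power series solving `B = 1 + 2 X B³` satisfies a linear differential equation of order two. -/
theorem ode_of_cubic {B : ℚ⟦X⟧} (h : B = 1 + 2 * X * B ^ 3) :
    4 * X * d⁄dX ℚ (d⁄dX ℚ B) + 6 * d⁄dX ℚ B =
      54 * X ^ 2 * d⁄dX ℚ (d⁄dX ℚ B) + 108 * X * d⁄dX ℚ B + 12 * B := by
  have d2 : d⁄dX ℚ (2 : ℚ⟦X⟧) = 0 := by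
    exact_mod_cast (d⁄dX ℚ).map_natCast 2
  have d3 : d⁄dX ℚ (3 : ℚ⟦X⟧) = 0 := by
    exact_mod_cast (d⁄dX ℚ).map_natCast 3
  have h0 : constantCoeff B = 1 := by
    have := congrArg constantCoeff h
    simpa using this
  set p := d⁄dX ℚ B with hp
  set q := d⁄dX ℚ p with hq
  have e1 : p = 2 * B ^ 3 + 6 * X * B ^ 2 * p := by
    have := congrArg (d⁄dX ℚ) h
    simp only [map_add, Derivation.leibniz, Derivation.leibniz_pow, derivative_one, derivative_X,
      d2, ← hp, smul_eq_mul, nsmul_eq_mul] at this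
    push_cast at this
    linear_combination this
  -- Multiplying by `B` and using `2XB³ = B - 1` eliminates `X`.
  have e2 : (3 - 2 * B) * p = 2 * B ^ 4 := by
    linear_combination B * e1 + (-3 * p) * h
  have e3 : (3 - 2 * B) * q = 2 * p ^ 2 + 8 * B ^ 3 * p := by
    have := congrArg (d⁄dX ℚ) e2
    simp only [map_sub, Derivation.leibniz, Derivation.leibniz_pow,
      d2, d3, ← hp, ← hq, smul_eq_mul, nsmul_eq_mul] at this
    push_cast at this
    linear_combination this
  have e4 : (3 - 2 * B) ^ 3 * q = 24 * B ^ 7 * (2 - B) := by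
    linear_combination (3 - 2 * B) ^ 2 * e3 +
      (2 * (3 - 2 * B) * p + 4 * B ^ 4 + 8 * B ^ 3 * (3 - 2 * B)) * e2
  have hS : (3 - 2 * B) ^ 3 ≠ 0 := by
    refine pow_ne_zero _ fun h' => ?_
    have := congrArg constantCoeff h'
    have c2 : constantCoeff (2 : ℚ⟦X⟧) = 2 := map_ofNat _ 2
    have c3 : constantCoeff (3 : ℚ⟦X⟧) = 3 := map_ofNat _ 3
    simp only [map_sub, map_mul, h0, c2, c3, map_zero] at this
    norm_num at this
  -- After this multiplication `e2` and `e4` turn the derivatives into polynomials in `B`; the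
  -- resulting polynomial identity in `X` and `B` holds modulo the cubic.
  apply mul_left_cancel₀ hS
  linear_combination (4 * X - 54 * X ^ 2) * e4 + (6 - 108 * X) * (3 - 2 * B) ^ 2 * e2 -
    (48 * B ^ 4 * (2 - B) - 324 * B * (2 - B) * (2 * X * B ^ 3 + (B - 1))
      - 108 * B * (3 - 2 * B) ^ 2) * h

theorem coeff_succ_of_cubic {B : ℚ⟦X⟧} (h : B = 1 + 2 * X * B ^ 3) (n : ℕ) :
    ((n : ℚ) + 1) * (4 * n + 6) * coeff (n + 1) B = 6 * (3 * n + 1) * (3 * n + 2) * coeff n B := by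
  have e := congrArg (coeff n) (ode_of_cubic h)
  have c (k : ℕ) [k.AtLeastTwo] : (OfNat.ofNat k : ℚ⟦X⟧) = C (OfNat.ofNat k : ℚ) :=
    (map_ofNat C k).symm
  simp only [c, mul_assoc, map_add, coeff_C_mul] at e
  -- The factor `X ^ 2` shifts coefficients by two, so `0` and `1` are separate cases.
  rcases n with _ | _ | n
  · simp [coeff_derivative, coeff_zero_X_mul, pow_two, mul_assoc] at e ⊢
    linear_combination e / 6
  · simp [coeff_derivative, coeff_succ_X_mul, pow_two, mul_assoc] at e ⊢
    linear_combination e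
  · simp only [coeff_derivative, coeff_succ_X_mul, pow_two, mul_assoc] at e
    push_cast at e ⊢
    linear_combination e

open scoped Nat in
theorem coeff_of_cubic {B : ℚ⟦X⟧} (h : B = 1 + 2 * X * B ^ 3) (n : ℕ) :
    coeff n B = 2 ^ n / (2 * n + 1) * ((3 * n).choose n : ℚ) := by
  have key (n : ℕ) : ((3 * n).choose n : ℚ) = (3 * n)! / (n ! * (2 * n)!) := by
    rw [Nat.cast_choose ℚ (by lia), show 3 * n - n = 2 * n by lia]
  induction n with
  | zero =>
    have := congrArg constantCoeff h
    simpa using this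
  | succ n ih =>
    have e := coeff_succ_of_cubic h n
    rw [ih, key] at e
    rw [key, show 3 * (n + 1) = 3 * n + 1 + 1 + 1 by ring, show 2 * (n + 1) = 2 * n + 1 + 1 by ring]
    simp only [Nat.factorial_succ]
    push_cast
    have h1 : ((n : ℚ) + 1) * (4 * n + 6) ≠ 0 := by positivity
    apply mul_left_cancel₀ h1
    rw [e]
    have := Nat.factorial_pos n
    have := Nat.factorial_pos (2 * n)
    have h3 : (2 * ((n : ℚ) + 1) + 1) ≠ 0 := by positivity
    field_simp
    ring

/-- The compositional inverse `w` of `X / (2(1 + X)³)` satisfies `w = 2X(1 + w)³`, so `1 + w` is a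
solution. -/
theorem exists_cubic : ∃ B : ℚ⟦X⟧, B = 1 + 2 * X * B ^ 3 := by
  set P : ℚ⟦X⟧ := X * (C 2 * (1 + X) ^ 3)⁻¹ with hP
  have hc : constantCoeff (C 2 * (1 + X) ^ 3 : ℚ⟦X⟧) ≠ 0 := by simp
  have h1 : IsUnit (P.coeff 1) := by
    rw [hP, coeff_succ_X_mul]; simp
  have h0 : constantCoeff P = 0 := by simp [hP]
  set w := P.substInvOfIsUnit h1 with hw
  have hs : HasSubst w := HasSubst.of_constantCoeff_zero' (constantCoeff_substInvOfIsUnit P h1)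
  have e : P.subst w = X := subst_substInvOfIsUnit_right P h0 h1
  have e' : P * (C 2 * (1 + X) ^ 3) = X := by
    rw [hP, mul_assoc, PowerSeries.inv_mul_cancel _ hc, mul_one]
  let φ : ℚ⟦X⟧ →ₐ[ℚ] ℚ⟦X⟧ := substAlgHom hs
  have hφ (f : ℚ⟦X⟧) : φ f = f.subst w := congrFun (coe_substAlgHom hs) f
  have e2 := congrArg φ e'
  have hφX : φ X = w := by rw [hφ, subst_X hs]
  have hφC : φ (C 2) = 2 := by rw [map_ofNat, map_ofNat]
  rw [map_mul φ P, map_mul φ (C 2), map_pow, map_add, map_one, hφX, hφC, hφ, e] at e2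
  refine ⟨1 + w, ?_⟩
  linear_combination -e2

/-- Subtracting the equations leaves `Y - Z` times a series with constant term `1`. -/
theorem eq_of_cubic {g Y Z : ℚ⟦X⟧} (hg : constantCoeff g = 0)
    (hY : Y = 1 + 2 * g * Y ^ 3) (hZ : Z = 1 + 2 * g * Z ^ 3) : Y = Z := by
  have h : (Y - Z) * (1 - 2 * g * (Y ^ 2 + Y * Z + Z ^ 2)) = 0 := by
    linear_combination hY - hZ
  rcases mul_eq_zero.1 h with h | h
  · exact sub_eq_zero.1 h
  · have := congrArg constantCoeff h
    simp [hg] at this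

/-- This is the expansion of `(1 - X)^-(d + 1)` with `X` replaced by `-X`. -/
theorem coeff_inv_one_add_X_pow (d k : ℕ) :
    coeff k (((1 + X) ^ (d + 1) : ℚ⟦X⟧)⁻¹) = (-1) ^ k * ((d + k).choose d : ℚ) := by
  have h := congrArg (rescale (-1 : ℚ)) (mk_add_choose_mul_one_sub_pow_eq_one ℚ d)
  have hX : rescale (-1 : ℚ) X = -X := by simp
  rw [map_mul, map_pow, map_sub, map_one, hX, sub_neg_eq_add] at h
  have : ((1 + X) ^ (d + 1) : ℚ⟦X⟧)⁻¹ = rescale (-1 : ℚ) (mk fun n => ((d + n).choose d : ℚ)) := by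
    rw [eq_comm, PowerSeries.eq_inv_iff_mul_eq_one (by simp)]
    exact h
  rw [this, coeff_rescale, coeff_mk]

/-- With `J = 1 / (1 + X)` and `g = XJ³`, uniqueness gives `F = J · B(g)`. The `i`-th term of the
expansion contains `J gⁱ = Xⁱ / (1 + X)^(3i + 1)`. -/
theorem coeff_of_cubic_sub {F : ℚ⟦X⟧} (h : F + X * F = 1 + 2 * X * F ^ 3) (n : ℕ) :
    coeff n F = ∑ i ∈ Finset.range (n + 1),
        (-1 : ℚ) ^ (n - i) * ((2 : ℚ) ^ i / (2 * (i : ℚ) + 1)) *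
          (Nat.choose (3 * i) i : ℚ) * (Nat.choose (n + 2 * i) (3 * i) : ℚ) := by
  obtain ⟨B, hB⟩ := exists_cubic
  set J : ℚ⟦X⟧ := (1 + X)⁻¹ with hJ
  have hJ1 : (1 + X) * J = 1 := PowerSeries.mul_inv_cancel _ (by simp)
  set g : ℚ⟦X⟧ := X * J ^ 3 with hg
  have hg0 : constantCoeff g = 0 := by simp [hg]
  have hs : HasSubst g := HasSubst.of_constantCoeff_zero' hg0
  let φ : ℚ⟦X⟧ →ₐ[ℚ] ℚ⟦X⟧ := substAlgHom hs
  have hφ (f : ℚ⟦X⟧) : φ f = f.subst g := congrFun (coe_substAlgHom hs) f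
  have hφX : φ X = g := by rw [hφ, subst_X hs]
  have e1 : B.subst g = 1 + 2 * g * B.subst g ^ 3 := by
    have := congrArg φ hB
    rwa [map_add, map_mul, map_mul, map_pow, map_one, map_ofNat, hφX, hφ] at this
  have e2 : (1 + X) * F = 1 + 2 * g * ((1 + X) * F) ^ 3 := by
    have : (1 + X) ^ 3 * J ^ 3 = 1 := by rw [← mul_pow, hJ1, one_pow]
    linear_combination h - 2 * X * F ^ 3 * this
  have e3 : F = J * B.subst g := by
    rw [eq_of_cubic hg0 e1 e2]
    linear_combination -F * hJ1
  -- Truncation replaces an infinite sum: after substitution the tail is divisible by `g ^ (n + 1)`,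
  -- hence by `X ^ (n + 1)`, and does not affect the coefficient.
  obtain ⟨R, hR⟩ : ∃ R, B = R * X ^ (n + 1) + (B.trunc (n + 1) : ℚ⟦X⟧) :=
    ⟨_, eq_shift_mul_X_pow_add_trunc (n + 1) B⟩
  have e4 : B.subst g =
      (∑ i ∈ Finset.range (n + 1), C (coeff i B) * g ^ i) + g ^ (n + 1) * R.subst g := by
    have hC (r : ℚ) : φ (C r) = C r := φ.commutes r
    have := congrArg φ hR
    rw [map_add, map_mul, map_pow, hφX, hφ, hφ] at this
    rw [this, add_comm, mul_comm]
    congr 1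
    rw [trunc_apply, ← Finset.range_eq_Ico]
    simp only [← Polynomial.coeToPowerSeries.ringHom_apply, map_sum,
      ← Polynomial.C_mul_X_pow_eq_monomial,
      map_mul, map_pow]
    simp [hφX, hC]
  rw [e3, e4, mul_add, map_add, Finset.mul_sum, map_sum]
  have e5 : coeff n (J * (g ^ (n + 1) * R.subst g)) = 0 := by
    rw [hg, show J * ((X * J ^ 3) ^ (n + 1) * R.subst (X * J ^ 3)) =
      X ^ (n + 1) * (J * (J ^ 3) ^ (n + 1) * R.subst (X * J ^ 3)) by ring, coeff_X_pow_mul']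
    simp
  rw [e5, add_zero]
  refine Finset.sum_congr rfl fun i hi => ?_
  have hi : i ≤ n := by simpa [Nat.lt_succ_iff] using hi
  rw [hg, show J * (C (coeff i B) * (X * J ^ 3) ^ i) = C (coeff i B) * (X ^ i * J ^ (3 * i + 1)) by
    ring, coeff_C_mul, coeff_X_pow_mul', if_pos hi, hJ, coeff_of_cubic hB]
  have : ((1 + X : ℚ⟦X⟧)⁻¹) ^ (3 * i + 1) = ((1 + X) ^ (3 * i + 1))⁻¹ := by
    rw [eq_comm, PowerSeries.inv_eq_iff_mul_eq_one (by simp), ← mul_pow, ← hJ, mul_comm, hJ1, one_pow]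
  rw [this, coeff_inv_one_add_X_pow, show 3 * i + (n - i) = n + 2 * i by lia]
  ring

end PowerSeries

/-! ### Counting good ternary trees. -/

/-- Ternary trees whose nodes carry a Boolean. -/
inductive TernaryTree where
  | leaf
  | node (s : Bool) (A B C : TernaryTree)

namespace TernaryTree

/-- The number of nodes. -/
def size : TernaryTree → ℕ
  | leaf => 0
  | node _ A B C => A.size + B.size + C.size + 1

/-- No node carries `false` while its first two subtrees are leaves. -/
def IsGood : TernaryTree → Prop
  | leaf => True
  | node s A B C => A.IsGood ∧ B.IsGood ∧ C.IsGood ∧ (s = true ∨ A ≠ leaf ∨ B ≠ leaf)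

/-- The good trees with `n` nodes. -/
def goodSet (n : ℕ) : Set TernaryTree := {t | t.IsGood ∧ t.size = n}

theorem size_eq_zero {t : TernaryTree} : t.size = 0 ↔ t = leaf := by
  cases t <;> simp [size]

theorem finite_setOf_size_eq (n : ℕ) : {t : TernaryTree | t.size = n}.Finite := by
  induction n using Nat.strong_induction_on with
  | _ n ih =>
    have h : (⋃ m ∈ Set.Iio n, {t : TernaryTree | t.size = m}).Finite :=
      (Set.finite_Iio n).biUnion fun m hm => ih m hm
    set U := ⋃ m ∈ Set.Iio n, {t : TernaryTree | t.size = m}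
    refine ((((Set.finite_univ (α := Bool)).prod (h.prod (h.prod h))).image
      fun x => node x.1 x.2.1 x.2.2.1 x.2.2.2).insert leaf).subset ?_
    rintro (_ | ⟨s, A, B, C⟩) ht
    · exact Set.mem_insert _ _
    · simp only [Set.mem_ofPred_eq, size] at ht
      refine Set.mem_insert_of_mem _ ⟨(s, A, B, C), ⟨Set.mem_univ _, ?_, ?_, ?_⟩, rfl⟩ <;>
        simp [U] <;> lia

theorem finite_goodSet (n : ℕ) : (goodSet n).Finite :=
  (finite_setOf_size_eq n).subset fun _ h => h.2

/-- The good trees with `n` nodes, as a finite set. -/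
noncomputable def goodFinset (n : ℕ) : Finset TernaryTree := (finite_goodSet n).toFinset

theorem mem_goodFinset {n : ℕ} {t : TernaryTree} : t ∈ goodFinset n ↔ t.IsGood ∧ t.size = n := by
  simp [goodFinset, goodSet]

/-- The triples of good trees with `n` nodes in total. -/
noncomputable def goodTriples (n : ℕ) :
    Finset ((_ : ℕ × ℕ) × (_ : ℕ × ℕ) × TernaryTree × TernaryTree × TernaryTree) :=
  (Finset.HasAntidiagonal.antidiagonal n).sigma fun p => (Finset.HasAntidiagonal.antidiagonal p.1).sigma fun q =>
    goodFinset q.1 ×ˢ goodFinset q.2 ×ˢ goodFinset p.2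

/-- A Boolean and three good subtrees form either a good tree or `node false leaf leaf C`; the bad
ones are indexed by the good trees `C` with `n` nodes. -/
theorem card_goodFinset_succ (n : ℕ) :
    (goodFinset (n + 1)).card + (goodFinset n).card = 2 * (goodTriples n).card := by
  classical
  have h : (goodFinset (n + 1)).disjUnion ((goodFinset n).image (node false leaf leaf)) (by
      rw [Finset.disjoint_left]
      rintro _ h1 h2
      obtain ⟨C, -, rfl⟩ := Finset.mem_image.1 h2
      simp [mem_goodFinset, IsGood] at h1) =
    ((Finset.univ : Finset Bool) ×ˢ goodTriples n).image
      fun x => node x.1 x.2.2.2.1 x.2.2.2.2.1 x.2.2.2.2.2 := by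
    ext t
    simp only [Finset.mem_disjUnion, Finset.mem_image, mem_goodFinset, Finset.mem_product,
      Finset.mem_univ, true_and, goodTriples, Finset.mem_sigma, Finset.HasAntidiagonal.mem_antidiagonal]
    constructor
    · rintro (⟨h1, h2⟩ | ⟨C, ⟨h1, h2⟩, rfl⟩)
      · rcases t with _ | ⟨s, A, B, C⟩
        · simp [size] at h2
        · simp only [size, IsGood] at h1 h2
          exact ⟨(s, ⟨(A.size + B.size, C.size), (A.size, B.size), A, B, C⟩),
            ⟨by lia, rfl, ⟨h1.1, rfl⟩, ⟨h1.2.1, rfl⟩, h1.2.2.1, rfl⟩, rfl⟩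
      · exact ⟨(false, ⟨(0, n), (0, 0), leaf, leaf, C⟩),
          ⟨by simp, rfl, ⟨trivial, rfl⟩, ⟨trivial, rfl⟩, h1, h2⟩, rfl⟩
    · rintro ⟨⟨s, p, q, A, B, C⟩, ⟨hp, hq, ⟨hA, hA'⟩, ⟨hB, hB'⟩, hC, hC'⟩, rfl⟩
      dsimp only at *
      by_cases hg : s = true ∨ A ≠ leaf ∨ B ≠ leaf
      · exact Or.inl ⟨⟨hA, hB, hC, hg⟩, by simp only [size]; lia⟩
      · push Not at hg
        obtain ⟨hs, rfl, rfl⟩ := hg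
        simp only [size] at hA' hB'
        exact Or.inr ⟨C, ⟨hC, by lia⟩, by simp at hs; rw [hs]⟩
  have hc := congrArg Finset.card h
  rw [Finset.card_disjUnion, Finset.card_image_of_injective _ (fun _ _ h => by simpa using h),
    Finset.card_image_of_injOn, Finset.card_product] at hc
  · simpa using hc
  -- The antidiagonal indices are sums of subtree sizes, so the node determines them.
  · rintro ⟨s, ⟨p1, p2⟩, ⟨q1, q2⟩, A, B, C⟩ h1 ⟨s', ⟨p1', p2'⟩, ⟨q1', q2'⟩, A', B', C'⟩ h2 e
    simp only [Finset.coe_product, Set.mem_prod, Finset.mem_coe, goodTriples, Finset.mem_sigma,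
      Finset.HasAntidiagonal.mem_antidiagonal, Finset.mem_product, mem_goodFinset] at h1 h2
    simp only [node.injEq] at e
    obtain ⟨rfl, rfl, rfl, rfl⟩ := e
    obtain ⟨-, a1, a2, ⟨-, a3⟩, ⟨-, a4⟩, -, a5⟩ := h1
    obtain ⟨-, b1, b2, ⟨-, b3⟩, ⟨-, b4⟩, -, b5⟩ := h2
    obtain rfl : q1 = q1' := by lia
    obtain rfl : q2 = q2' := by lia
    obtain rfl : p1 = p1' := by lia
    obtain rfl : p2 = p2' := by lia
    rfl

open PowerSeries in
theorem cubic_goodFinset :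
    (mk fun n => ((goodFinset n).card : ℚ)) + X * (mk fun n => ((goodFinset n).card : ℚ)) =
      1 + 2 * X * (mk fun n => ((goodFinset n).card : ℚ)) ^ 3 := by
  ext n
  set F : ℚ⟦X⟧ := mk fun n => ((goodFinset n).card : ℚ) with hF
  have h2 : (2 : ℚ⟦X⟧) = C 2 := (map_ofNat C 2).symm
  rw [h2, mul_assoc, map_add, map_add, coeff_C_mul]
  rcases n with _ | n
  · have : goodFinset 0 = {leaf} := by
      ext t
      simp only [mem_goodFinset, size_eq_zero, Finset.mem_singleton]
      exact ⟨fun h => h.2, fun h => ⟨h ▸ trivial, h⟩⟩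
    simp [hF, this]
  · rw [coeff_succ_X_mul, coeff_succ_X_mul, pow_succ, pow_two, coeff_mul]
    simp only [coeff_mul, hF, coeff_mk, coeff_one]
    have h := card_goodFinset_succ n
    simp only [goodTriples, Finset.card_sigma, Finset.card_product] at h
    have h' := congrArg (Nat.cast : ℕ → ℚ) h
    push_cast at h'
    simp only [Finset.sum_mul, mul_assoc] at h' ⊢
    simpa using h'

theorem card_goodFinset (n : ℕ) :
    ((goodFinset n).card : ℚ) = ∑ i ∈ Finset.range (n + 1),
        (-1 : ℚ) ^ (n - i) * ((2 : ℚ) ^ i / (2 * (i : ℚ) + 1)) *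
          (Nat.choose (3 * i) i : ℚ) * (Nat.choose (n + 2 * i) (3 * i) : ℚ) := by
  rw [← PowerSeries.coeff_of_cubic_sub cubic_goodFinset, PowerSeries.coeff_mk]

end TernaryTree

/-! ### Non-crossing trees on intervals, and gluing them. -/

namespace SimpleGraph

theorem Reachable.exists_adj_of_not {V : Type*} {G : SimpleGraph V} {u v : V} {p : V → Prop}
    (h : G.Reachable u v) (hu : p u) (hv : ¬ p v) :
    ∃ x y, G.Reachable u x ∧ G.Adj x y ∧ p x ∧ ¬ p y := by
  rw [reachable_iff_reflTransGen] at h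
  induction h with
  | refl => exact absurd hu hv
  | @tail y z hy hyz ih =>
    by_cases hpy : p y
    · exact ⟨y, z, (reachable_iff_reflTransGen _ _).2 hy, hyz, hpy, hv⟩
    · exact ih hpy

theorem Reachable.induct {V : Type*} {G : SimpleGraph V} {u v : V} {p : V → Prop}
    (h : G.Reachable u v) (hu : p u)
    (step : ∀ x y, G.Reachable u x → G.Adj x y → p x → p y) : p v := by
  by_contra hv
  obtain ⟨x, y, h1, h2, h3, h4⟩ := h.exists_adj_of_not hu hv
  exact h4 (step x y h1 h2 h3)

/-- All edges of `G` have their ends in `[a, b]`. -/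
def SupportedOn (G : SimpleGraph ℕ) (a b : ℕ) : Prop :=
  ∀ ⦃x y⦄, G.Adj x y → a ≤ x ∧ x ≤ b

/-- All points of `[a, b]` are in one component of `G`. -/
def ConnectedOn (G : SimpleGraph ℕ) (a b : ℕ) : Prop :=
  ∀ ⦃x⦄, a ≤ x → x ≤ b → G.Reachable a x

/-- The graph on `Fin (n + 1)` obtained from the points `a, …, a + n`. -/
def window (G : SimpleGraph ℕ) (a n : ℕ) : SimpleGraph (Fin (n + 1)) :=
  G.comap fun i => a + i

theorem SupportedOn.connected_window_iff {G : SimpleGraph ℕ} {a n : ℕ}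
    (hG : G.SupportedOn a (a + n)) : (G.window a n).Connected ↔ G.ConnectedOn a (a + n) := by
  constructor
  · intro h x h1 h2
    have h3 := (h.preconnected 0 ⟨x - a, by lia⟩).map (⟨fun i => a + i, fun h => h⟩ : G.window a n →g G)
    have h4 : a + (x - a) = x := by lia
    change G.Reachable (a + 0) (a + (x - a)) at h3
    rwa [h4] at h3
  · intro h
    have key : ∀ x : ℕ, G.Reachable a x → ∀ i : Fin (n + 1), a + i = x →
        (G.window a n).Reachable 0 i := by
      intro x hx
      refine hx.induct (p := fun x => ∀ i : Fin (n + 1), a + i = x →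
        (G.window a n).Reachable 0 i) ?_ ?_
      · intro i hi
        rw [show i = 0 by ext; simp; lia]
      · intro x y _ hxy ih i hi
        have := hG hxy
        refine (ih ⟨x - a, by lia⟩ (by simp; lia)).trans (Adj.reachable ?_)
        change G.Adj (a + (x - a)) (a + i)
        rwa [hi, show a + (x - a) = x by lia]
    have h0 (i : Fin (n + 1)) : (G.window a n).Reachable 0 i :=
      key _ (h (by lia) (by lia)) i rfl
    exact ⟨fun i j => (h0 i).symm.trans (h0 j)⟩

theorem SupportedOn.encard_edgeSet_window {G : SimpleGraph ℕ} {a n : ℕ}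
    (hG : G.SupportedOn a (a + n)) : (G.window a n).edgeSet.encard = G.edgeSet.encard := by
  have hinj : Function.Injective fun i : Fin (n + 1) => a + (i : ℕ) := fun i j h => by
    ext; simpa using h
  rw [← (Sym2.map.injective hinj).encard_image]
  congr 1
  ext e
  constructor
  · rintro ⟨e, he, rfl⟩
    induction e with
    | _ x y => exact he
  · induction e with
    | _ x y =>
      intro he
      have h1 := hG (show G.Adj x y from he)
      have h2 := hG (show G.Adj y x from he.symm)
      refine ⟨s(⟨x - a, by lia⟩, ⟨y - a, by lia⟩), ?_, ?_⟩
      · change G.Adj (a + (x - a)) (a + (y - a))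
        rwa [show a + (x - a) = x by lia, show a + (y - a) = y by lia]
      · simp [show a + (x - a) = x by lia, show a + (y - a) = y by lia]

theorem ConnectedOn.le_encard {G : SimpleGraph ℕ} {a b : ℕ} (hab : a ≤ b)
    (hG : G.SupportedOn a b) (h : G.ConnectedOn a b) : ((b - a : ℕ) : ℕ∞) ≤ G.edgeSet.encard := by
  obtain ⟨n, rfl⟩ := Nat.exists_eq_add_of_le hab
  have h1 := (hG.connected_window_iff.2 h).card_vert_le_card_edgeSet_add_one
  rw [← hG.encard_edgeSet_window, ← Set.Finite.cast_ncard_eq (Set.toFinite _)]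
  rw [Nat.card_coe_set_eq, Nat.card_fin] at h1
  exact_mod_cast (by lia : a + n - a ≤ (G.window a n).edgeSet.ncard)

/-- `G` is a non-crossing tree on the points `a, …, b`. -/
structure IsTreeOn (G : SimpleGraph ℕ) (a b : ℕ) : Prop where
  supported : G.SupportedOn a b
  nonCrossing : ∀ ⦃p q r s⦄, p < q → q < r → r < s → G.Adj p r → ¬ G.Adj q s
  connected : G.ConnectedOn a b
  encard_edgeSet : G.edgeSet.encard = (b - a : ℕ)

theorem SupportedOn.isTree_window_iff {G : SimpleGraph ℕ} {a n : ℕ}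
    (hG : G.SupportedOn a (a + n)) :
    (G.window a n).IsTree ↔ G.ConnectedOn a (a + n) ∧ G.edgeSet.encard = n := by
  rw [isTree_iff_connected_and_card, hG.connected_window_iff, ← hG.encard_edgeSet_window,
    ← Set.Finite.cast_ncard_eq (Set.toFinite _), Nat.card_coe_set_eq, Nat.card_fin, Nat.cast_inj,
    Nat.add_right_cancel_iff]

/-- The union of three graphs and the edge from `a` to `m`. -/
def glue (A B C : SimpleGraph ℕ) (a m : ℕ) : SimpleGraph ℕ := A ⊔ B ⊔ C ⊔ edge a m

theorem glue_adj {A B C : SimpleGraph ℕ} {a m x y : ℕ} (h : a < m) : (glue A B C a m).Adj x y ↔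
    A.Adj x y ∨ B.Adj x y ∨ C.Adj x y ∨ (x = a ∧ y = m ∨ x = m ∧ y = a) := by
  simp only [glue, sup_adj, edge_adj]
  grind

section glue

variable {A B C : SimpleGraph ℕ} {a k m b : ℕ}

/-- The three intervals share at most the point `m`, and no piece contains both `a` and `m`, so no
edge is counted twice. -/
theorem encard_edgeSet_glue (hak : a ≤ k) (hkm : k < m)
    (hA : A.SupportedOn a k) (hB : B.SupportedOn (k + 1) m) (hC : C.SupportedOn m b) :
    (glue A B C a m).edgeSet.encard =
      A.edgeSet.encard + B.edgeSet.encard + C.edgeSet.encard + 1 := by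
  have disj {G H : SimpleGraph ℕ} (h : ∀ x y, G.Adj x y → ¬ H.Adj x y) :
      Disjoint G.edgeSet H.edgeSet := by
    rw [Set.disjoint_left]
    intro e
    induction e with
    | _ x y => exact h x y
  rw [glue, edgeSet_sup, edgeSet_sup, edgeSet_sup, edgeSet_edge_of_ne (by lia),
    Set.encard_union_eq, Set.encard_union_eq, Set.encard_union_eq, Set.encard_singleton]
  · refine disj fun x y h1 h2 => ?_
    have := hA h1; have := hB h2; lia
  · rw [← edgeSet_sup]
    refine disj fun x y h1 h2 => ?_
    have := hC h2; have := hC h2.symm; have := h2.ne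
    rcases h1 with h1 | h1
    · have := hA h1; lia
    · have := hB h1; have := hB h1.symm; lia
  · rw [Set.disjoint_singleton_right, ← edgeSet_sup, ← edgeSet_sup, mem_edgeSet]
    rintro ((h | h) | h)
    · have := hA h.symm; lia
    · have := hB h; lia
    · have := hC h; lia

theorem IsTreeOn.glue (hak : a ≤ k) (hkm : k < m) (hmb : m ≤ b)
    (hA : A.IsTreeOn a k) (hB : B.IsTreeOn (k + 1) m) (hC : C.IsTreeOn m b) :
    (glue A B C a m).IsTreeOn a b where
  supported x y h := by
    rw [glue_adj (by lia)] at h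
    rcases h with h | h | h | h
    · have := hA.supported h; lia
    · have := hB.supported h; lia
    · have := hC.supported h; lia
    · lia
  nonCrossing p q r s h1 h2 h3 h4 h5 := by
    rw [glue_adj (by lia)] at h4 h5
    have a1 := hA.nonCrossing h1 h2 h3
    have a2 := hB.nonCrossing h1 h2 h3
    have a3 := hC.nonCrossing h1 h2 h3
    have key {G : SimpleGraph ℕ} {c d x y : ℕ} (hG : G.SupportedOn c d) (h : G.Adj x y) :
        c ≤ x ∧ x ≤ d ∧ c ≤ y ∧ y ≤ d := ⟨(hG h).1, (hG h).2, hG h.symm⟩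
    have b1 := key (x := p) (y := r) hA.supported
    have b2 := key (x := p) (y := r) hB.supported
    have b3 := key (x := p) (y := r) hC.supported
    have c1 := key (x := q) (y := s) hA.supported
    have c2 := key (x := q) (y := s) hB.supported
    have c3 := key (x := q) (y := s) hC.supported
    grind
  connected := by
    have hAG : A ≤ SimpleGraph.glue A B C a m := fun x y h => (glue_adj (by lia)).2 (Or.inl h)
    have hBG : B ≤ SimpleGraph.glue A B C a m :=
      fun x y h => (glue_adj (by lia)).2 (Or.inr (Or.inl h))
    have hCG : C ≤ SimpleGraph.glue A B C a m :=
      fun x y h => (glue_adj (by lia)).2 (Or.inr (Or.inr (Or.inl h)))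
    have ham : (SimpleGraph.glue A B C a m).Reachable a m :=
      Adj.reachable ((glue_adj (by lia)).2 (by simp))
    intro x hax hxb
    by_cases h1 : x ≤ k
    · exact (hA.connected hax h1).mono hAG
    by_cases h2 : x ≤ m
    · exact ham.trans (((hB.connected (by lia) le_rfl).symm.trans
        (hB.connected (by lia) h2)).mono hBG)
    · exact ham.trans ((hC.connected (by lia) hxb).mono hCG)
  encard_edgeSet := by
    rw [encard_edgeSet_glue hak hkm hA.supported hB.supported hC.supported, hA.encard_edgeSet,
      hB.encard_edgeSet, hC.encard_edgeSet]
    norm_cast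
    lia

/-- The edges with both ends in `[a, b]`. -/
def restrictTo (G : SimpleGraph ℕ) (a b : ℕ) : SimpleGraph ℕ where
  Adj x y := G.Adj x y ∧ (a ≤ x ∧ x ≤ b) ∧ a ≤ y ∧ y ≤ b
  symm := ⟨fun _ _ h => ⟨h.1.symm, h.2.2, h.2.1⟩⟩
  loopless := ⟨fun _ h => h.1.ne rfl⟩

theorem restrictTo_glue (hak : a ≤ k) (hkm : k < m)
    (hA : A.SupportedOn a k) (hB : B.SupportedOn (k + 1) m) (hC : C.SupportedOn m b) :
    (SimpleGraph.glue A B C a m).restrictTo a k = A ∧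
    (SimpleGraph.glue A B C a m).restrictTo (k + 1) m = B ∧
    (SimpleGraph.glue A B C a m).restrictTo m b = C := by
  refine ⟨?_, ?_, ?_⟩ <;>
  · ext x y
    simp only [restrictTo, glue_adj (show a < m by lia)]
    constructor
    · rintro ⟨h | h | h | h, h1⟩ <;> first | exact h | lia | skip
      all_goals
        have := h.ne
        first
        | have := hA h; have := hA h.symm; lia
        | have := hB h; have := hB h.symm; lia
        | have := hC h; have := hC h.symm; lia
    · intro h
      first
      | exact ⟨Or.inl h, hA h, hA h.symm⟩
      | exact ⟨Or.inr (Or.inl h), hB h, hB h.symm⟩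
      | exact ⟨Or.inr (Or.inr (Or.inl h)), hC h, hC h.symm⟩

theorem glue_isGreatest (hkm : k < m) (hak : a ≤ k)
    (hA : A.SupportedOn a k) (hB : B.SupportedOn (k + 1) m) (hC : C.SupportedOn m b) :
    IsGreatest {x | (SimpleGraph.glue A B C a m).Adj a x} m := by
  refine ⟨(glue_adj (by lia)).2 (by simp), fun x hx => ?_⟩
  rcases (glue_adj (by lia)).1 hx with h | h | h | h
  · have := hA h.symm; lia
  · have := hB h; lia
  · have := hC h; lia
  · lia

/-- Connectedness of `A'` requires an edge from `[a, k]` to `[k + 1, k']`, but the only edge of the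
first glued graph leaving `[a, k]` ends at `m > k'`. -/
theorem glue_ne_glue_of_lt {A' B' C' : SimpleGraph ℕ} {k' : ℕ} (hk : k < k') (hkm : k' < m) (hak : a ≤ k)
    (hA : A.SupportedOn a k) (hB : B.SupportedOn (k + 1) m) (hC : C.SupportedOn m b)
    (hA' : A'.IsTreeOn a k')
    (h : SimpleGraph.glue A B C a m = SimpleGraph.glue A' B' C' a m) : False := by
  obtain ⟨x, y, -, hxy, hx, hy⟩ := (hA'.connected (by lia : a ≤ k + 1) (by lia)).exists_adj_of_not
    (p := fun x => x ≤ k) hak (by lia)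
  have := hA'.supported hxy.symm
  have hG : (SimpleGraph.glue A B C a m).Adj x y := h ▸ (glue_adj (by lia)).2 (Or.inl hxy)
  rcases (glue_adj (by lia)).1 hG with h | h | h | h
  · have := hA h.symm; lia
  · have := hB h; lia
  · have := hC h; lia
  · lia

/-- The point `m` is the largest neighbour of `a`, `k` is fixed by `glue_ne_glue_of_lt`, and
restriction recovers the pieces. -/
theorem glue_inj {A' B' C' : SimpleGraph ℕ} {k' m' : ℕ} (hak : a ≤ k) (hkm : k < m)
    (hak' : a ≤ k') (hkm' : k' < m')
    (hA : A.IsTreeOn a k) (hB : B.IsTreeOn (k + 1) m) (hC : C.IsTreeOn m b)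
    (hA' : A'.IsTreeOn a k') (hB' : B'.IsTreeOn (k' + 1) m') (hC' : C'.IsTreeOn m' b)
    (h : SimpleGraph.glue A B C a m = SimpleGraph.glue A' B' C' a m') :
    k = k' ∧ m = m' ∧ A = A' ∧ B = B' ∧ C = C' := by
  obtain rfl : m = m' :=
    (glue_isGreatest hkm hak hA.supported hB.supported hC.supported).unique
      (h ▸ glue_isGreatest hkm' hak' hA'.supported hB'.supported hC'.supported)
  obtain rfl : k = k' := by
    rcases lt_trichotomy k k' with hk | hk | hk
    · exact (glue_ne_glue_of_lt hk hkm' hak hA.supported hB.supported hC.supported hA' h).elim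
    · exact hk
    · exact (glue_ne_glue_of_lt hk hkm hak' hA'.supported hB'.supported hC'.supported hA h.symm).elim
  obtain ⟨h1, h2, h3⟩ := restrictTo_glue hak hkm hA.supported hB.supported hC.supported
  obtain ⟨h1', h2', h3'⟩ := restrictTo_glue hak hkm hA'.supported hB'.supported hC'.supported
  rw [← h] at h1' h2' h3'
  exact ⟨rfl, rfl, h1.symm.trans h1', h2.symm.trans h2', h3.symm.trans h3'⟩

end glue

theorem supportedOn_restrictTo (G : SimpleGraph ℕ) (a b : ℕ) : (G.restrictTo a b).SupportedOn a b :=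
  fun _ _ h => h.2.1

end SimpleGraph

/-! ### Splitting a non-crossing tree. -/

namespace SimpleGraph

/-- A non-crossing tree on at least two points `a, …, b` splits at the edge from `a` to its
largest neighbour `m` into three non-crossing trees. -/
theorem IsTreeOn.exists_glue {G : SimpleGraph ℕ} {a b : ℕ} (hG : G.IsTreeOn a b) (hab : a < b) :
    ∃ k m A B C, a ≤ k ∧ k < m ∧ m ≤ b ∧ IsTreeOn A a k ∧ IsTreeOn B (k + 1) m ∧ IsTreeOn C m b ∧
      G = SimpleGraph.glue A B C a m := by
  have greatest {S : Set ℕ} {u N : ℕ} (hu : u ∈ S) (hN : ∀ x ∈ S, x ≤ N) : ∃ m, IsGreatest S m :=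
    ⟨sSup S, Nat.sSup_mem ⟨u, hu⟩ ⟨N, hN⟩, fun x hx => le_csSup ⟨N, hN⟩ hx⟩
  obtain ⟨m, ham, hmax⟩ : ∃ m, IsGreatest {x | G.Adj a x} m := by
    obtain ⟨x, y, -, hxy, rfl, -⟩ := (hG.connected hab.le le_rfl).exists_adj_of_not
      (p := fun x => x = a) rfl hab.ne'
    exact greatest hxy fun z hz => (hG.supported (Adj.symm hz)).2
  replace ham : G.Adj a m := ham
  have hmb := (hG.supported ham.symm).2
  have hlt : a < m := lt_of_le_of_ne (hG.supported ham.symm).1 ham.ne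
  have cross {x y : ℕ} (hxy : G.Adj x y) (h1 : a < x) (h2 : x < m) (h3 : m < y) : False :=
    hG.nonCrossing h1 h2 h3 ham hxy
  set D := G.deleteEdges {s(a, m)} with hD
  have hDG : D ≤ G := deleteEdges_le _
  have hGD {x y : ℕ} (h : G.Adj x y) : D.Adj x y ∨ (x = a ∧ y = m) ∨ (x = m ∧ y = a) := by
    by_cases h' : s(x, y) = s(a, m)
    · right; simpa [Sym2.eq_iff] using h'
    · left; exact deleteEdges_adj.2 ⟨h, h'⟩
  have hDcard : D.edgeSet.encard + 1 = (b - a : ℕ) := by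
    rw [hD, edgeSet_deleteEdges, Set.encard_sdiff_singleton_add_one ((mem_edgeSet G).2 ham),
      hG.encard_edgeSet]
  have hDs : D.SupportedOn a b := fun x y h => hG.supported (hDG h)
  have reach {x : ℕ} (h1 : a ≤ x) (h2 : x ≤ b) : D.Reachable a x ∨ D.Reachable m x := by
    refine (hG.connected h1 h2).induct (p := fun x => D.Reachable a x ∨ D.Reachable m x)
      (Or.inl .rfl) fun x y _ hxy h => ?_
    rcases hGD hxy with h' | ⟨rfl, rfl⟩ | ⟨rfl, rfl⟩
    · exact h.imp (fun h => h.trans h'.reachable) (fun h => h.trans h'.reachable)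
    · exact Or.inr .rfl
    · exact Or.inl .rfl
  -- Otherwise `D` would be connected on `[a, b]` with one edge too few.
  have hnr : ¬ D.Reachable a m := by
    intro h
    have hc : D.ConnectedOn a b := fun x h1 h2 => (reach h1 h2).elim id fun h' => h.trans h'
    have := hc.le_encard hab.le hDs
    rw [← hDcard] at this
    have hfin : D.edgeSet.encard ≠ ⊤ := by
      intro h
      rw [h, top_add] at hDcard
      exact ENat.natCast_ne_top _ hDcard.symm
    lift D.edgeSet.encard to ℕ using hfin with c
    norm_cast at this
    lia
  -- An edge jumping over `m` would contradict the maximality of `m` if it starts at `a`, and cross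
  -- `am` otherwise.
  have hR {x : ℕ} (h : D.Reachable a x) : a ≤ x ∧ x < m := by
    refine h.induct (p := fun x => a ≤ x ∧ x < m) ⟨le_rfl, hlt⟩ fun x y hx hxy hp => ?_
    refine ⟨(hDs hxy.symm).1, ?_⟩
    have hy : y ≠ m := by
      rintro rfl
      exact hnr (hx.trans hxy.reachable)
    by_contra hlt'
    rcases eq_or_lt_of_le hp.1 with rfl | h1
    · have := hmax (hDG hxy); lia
    · exact cross (hDG hxy) h1 hp.2 (by lia)
  obtain ⟨k, hk, hkmax⟩ : ∃ k, IsGreatest {x | D.Reachable a x} k :=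
    greatest (Reachable.refl (G := D) a) fun x hx => (hR hx).2.le
  replace hk : D.Reachable a k := hk
  have hak := (hR hk).1
  have hkm := (hR hk).2
  -- The component of `a` is an interval: if it missed `x`, one of its edges `uv` would pass over
  -- `x`, and a path from `m` to `x` would have to cross `uv`, since the components are disjoint.
  have hRk {x : ℕ} : D.Reachable a x ↔ a ≤ x ∧ x ≤ k := by
    refine ⟨fun h => ⟨(hR h).1, hkmax h⟩, fun ⟨h1, h2⟩ => ?_⟩
    by_contra hx
    obtain ⟨u, v, hu, huv, hux, hvx⟩ := hk.exists_adj_of_not (p := fun z => z < x)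
      (lt_of_le_of_ne h1 (by rintro rfl; exact hx .rfl))
      (by have : k ≠ x := by
            rintro rfl
            exact hx hk
          lia)
    have hv := hu.trans huv.reachable
    have hvm := (hR hv).2
    have hvx' : v ≠ x := by rintro rfl; exact hx hv
    have hmx := (reach h1 (by lia)).resolve_left hx
    obtain ⟨s, t, hs, hst, hs', ht⟩ := hmx.exists_adj_of_not (p := fun z => ¬ (u < z ∧ z < v))
      (by lia) (by lia)
    rw [not_not] at ht
    have hsu : s ≠ u := by rintro rfl; exact hnr (hu.trans hs.symm)
    have hsv : s ≠ v := by rintro rfl; exact hnr (hv.trans hs.symm)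
    rcases lt_or_gt_of_ne hsu with h | h
    · exact hG.nonCrossing h ht.1 ht.2 (hDG hst) (hDG huv)
    · exact hG.nonCrossing ht.1 ht.2 (show v < s by lia) (hDG huv) (hDG hst.symm)
  have hMk {x : ℕ} (h1 : k < x) (h2 : x ≤ b) : D.Reachable m x :=
    (reach (by lia) h2).resolve_left fun h => by have := hRk.1 h; lia
  have hM {x : ℕ} (h : D.Reachable m x) : k < x ∧ x ≤ b := by
    have hx : a ≤ x ∧ x ≤ b :=
      h.induct (p := fun x => a ≤ x ∧ x ≤ b) ⟨by lia, hmb⟩ fun x y _ hxy _ => hDs hxy.symm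
    refine ⟨?_, hx.2⟩
    by_contra h'
    exact hnr ((hRk.2 ⟨hx.1, by lia⟩).trans h.symm)
  have side {x y : ℕ} (hxy : D.Adj x y) (hx : k < x) (hy : k < y) :
      (x ≤ m ∧ y ≤ m) ∨ (m ≤ x ∧ m ≤ y) := by
    by_contra h
    rcases lt_or_ge x m with h1 | h1
    · exact cross (hDG hxy) (by lia) h1 (by lia)
    · exact cross (hDG hxy.symm) (by lia) (by lia) (by lia : m < x)
  have hA : (D.restrictTo a k).ConnectedOn a k := by
    intro x h1 h2
    refine (hRk.2 ⟨h1, h2⟩).induct (p := fun x => (D.restrictTo a k).Reachable a x) .rfl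
      fun x y hx hxy ih => ih.trans (Adj.reachable ⟨hxy, hRk.1 hx, hRk.1 (hx.trans hxy.reachable)⟩)
  -- Both claims are carried together because a path may switch sides, which by `side` happens only
  -- at `m`, where both hold trivially.
  have hBC {x : ℕ} (h : D.Reachable m x) :
      (x ≤ m → (D.restrictTo (k + 1) m).Reachable m x) ∧
      (m ≤ x → (D.restrictTo m b).Reachable m x) := by
    refine h.induct (p := fun x => (x ≤ m → (D.restrictTo (k + 1) m).Reachable m x) ∧
      (m ≤ x → (D.restrictTo m b).Reachable m x)) ⟨fun _ => .rfl, fun _ => .rfl⟩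
      fun x y hx hxy ih => ?_
    have h1 := hM hx
    have h2 := hM (hx.trans hxy.reachable)
    rcases side hxy h1.1 h2.1 with h3 | h3
    · have hr := (ih.1 h3.1).trans (Adj.reachable (show (D.restrictTo (k + 1) m).Adj x y from
        ⟨hxy, ⟨h1.1, h3.1⟩, ⟨h2.1, h3.2⟩⟩))
      refine ⟨fun _ => hr, fun h => ?_⟩
      rw [show y = m by lia]
    · have hr := (ih.2 h3.1).trans (Adj.reachable (show (D.restrictTo m b).Adj x y from
        ⟨hxy, ⟨h3.1, h1.2⟩, ⟨h3.2, h2.2⟩⟩))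
      refine ⟨fun h => ?_, fun _ => hr⟩
      rw [show y = m by lia]
  have hB : (D.restrictTo (k + 1) m).ConnectedOn (k + 1) m := by
    have h {x : ℕ} (h1 : k < x) (h2 : x ≤ m) := (hBC (hMk h1 (by lia))).1 h2
    exact fun x h1 h2 => (h (by lia) (by lia)).symm.trans (h h1 h2)
  have hC : (D.restrictTo m b).ConnectedOn m b :=
    fun x h1 h2 => (hBC (hMk (by lia) h2)).2 h1
  have hglue : G = SimpleGraph.glue (D.restrictTo a k) (D.restrictTo (k + 1) m) (D.restrictTo m b) a m := by
    ext x y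
    rw [glue_adj hlt]
    constructor
    · intro hxy
      rcases hGD hxy with h | h | h
      · have hx := hDs h
        have hy := hDs h.symm
        by_cases hxk : x ≤ k
        · have h1 := hRk.2 ⟨hx.1, hxk⟩
          exact Or.inl ⟨h, hRk.1 h1, hRk.1 (h1.trans h.reachable)⟩
        · have h1 := hMk (by lia) hx.2
          have h2 := hM h1
          have h3 := hM (h1.trans h.reachable)
          rcases side h h2.1 h3.1 with h4 | h4
          · exact Or.inr (Or.inl ⟨h, ⟨h2.1, h4.1⟩, ⟨h3.1, h4.2⟩⟩)
          · exact Or.inr (Or.inr (Or.inl ⟨h, ⟨h4.1, h2.2⟩, ⟨h4.2, h3.2⟩⟩))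
      · exact Or.inr (Or.inr (Or.inr (Or.inl h)))
      · exact Or.inr (Or.inr (Or.inr (Or.inr h)))
    · rintro (h | h | h | ⟨rfl, rfl⟩ | ⟨rfl, rfl⟩)
      · exact hDG h.1
      · exact hDG h.1
      · exact hDG h.1
      · exact ham
      · exact ham.symm
  have hcard := encard_edgeSet_glue hak hkm (supportedOn_restrictTo D a k)
    (supportedOn_restrictTo D (k + 1) m) (supportedOn_restrictTo D m b)
  rw [← hglue, hG.encard_edgeSet] at hcard
  have cA := hA.le_encard hak (supportedOn_restrictTo D a k)
  have cB := hB.le_encard hkm (supportedOn_restrictTo D (k + 1) m)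
  have cC := hC.le_encard hmb (supportedOn_restrictTo D m b)
  have hnc (u v : ℕ) ⦃p q r s : ℕ⦄ (h1 : p < q) (h2 : q < r) (h3 : r < s)
      (h4 : (D.restrictTo u v).Adj p r) : ¬ (D.restrictTo u v).Adj q s :=
    fun h5 => hG.nonCrossing h1 h2 h3 (hDG h4.1) (hDG h5.1)
  -- The lower bounds from connectedness already add up to the total number of edges, so each is an
  -- equality.
  have hcards : (D.restrictTo a k).edgeSet.encard = (k - a : ℕ) ∧
      (D.restrictTo (k + 1) m).edgeSet.encard = (m - (k + 1) : ℕ) ∧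
      (D.restrictTo m b).edgeSet.encard = (b - m : ℕ) := by
    generalize (D.restrictTo a k).edgeSet.encard = x at *
    generalize (D.restrictTo (k + 1) m).edgeSet.encard = y at *
    generalize (D.restrictTo m b).edgeSet.encard = z at *
    have hx : x ≠ ⊤ := by rintro rfl; simp at hcard
    have hy : y ≠ ⊤ := by rintro rfl; simp at hcard
    have hz : z ≠ ⊤ := by rintro rfl; simp at hcard
    lift x to ℕ using hx
    lift y to ℕ using hy
    lift z to ℕ using hz
    norm_cast at *
    lia
  exact ⟨k, m, _, _, _, hak, hkm, hmb,
    ⟨supportedOn_restrictTo _ _ _, hnc _ _, hA, hcards.1⟩,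
    ⟨supportedOn_restrictTo _ _ _, hnc _ _, hB, hcards.2.1⟩,
    ⟨supportedOn_restrictTo _ _ _, hnc _ _, hC, hcards.2.2⟩, hglue⟩

/-- `G` is a non-crossing tree on `a, …, b`, and each of its edges spans a gap in `L`, where
`i ∈ L` stands for the gap between `i` and `i + 1`. -/
structure IsLevelFree (G : SimpleGraph ℕ) (L : Set ℕ) (a b : ℕ) : Prop where
  isTreeOn : G.IsTreeOn a b
  mem_Ico : ∀ i ∈ L, a ≤ i ∧ i < b
  exists_gap : ∀ ⦃x y⦄, x < y → G.Adj x y → ∃ i ∈ L, x ≤ i ∧ i < y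

end SimpleGraph

/-! ### Ternary trees encode level-free trees. -/

namespace TernaryTree

/-- The graph on `a, …, a + size` encoded by a ternary tree. -/
def graph : TernaryTree → ℕ → SimpleGraph ℕ
  | leaf, _ => ⊥
  | node _ A B C, a => SimpleGraph.glue (A.graph a) (B.graph (a + A.size + 1))
      (C.graph (a + A.size + 1 + B.size)) a (a + A.size + 1 + B.size)

/-- The set of gaps between `a, …, a + size` encoded by a ternary tree. -/
def gaps : TernaryTree → ℕ → Set ℕ
  | leaf, _ => ∅
  | node s A B C, a => A.gaps a ∪ B.gaps (a + A.size + 1) ∪ C.gaps (a + A.size + 1 + B.size) ∪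
      {i | s = true ∧ i = a + A.size}

theorem mem_Ico_of_mem_gaps {t : TernaryTree} {a i : ℕ} (h : i ∈ t.gaps a) :
    a ≤ i ∧ i < a + t.size := by
  induction t generalizing a with
  | leaf => exact h.elim
  | node s A B C hA hB hC =>
    simp only [size]
    rcases h with ((h | h) | h) | h
    · have := hA h; lia
    · have := hB h; lia
    · have := hC h; lia
    · have := h.2; lia

theorem isTreeOn_graph (t : TernaryTree) (a : ℕ) : (t.graph a).IsTreeOn a (a + t.size) := by
  induction t generalizing a with
  | leaf =>
    refine ⟨fun x y h => h.elim, fun _ _ _ _ _ _ _ h => h.elim, fun x h1 h2 => ?_, ?_⟩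
    · rw [show x = a by simp [size] at h2; lia]
    · simp [graph, size]
  | node s A B C hA hB hC =>
    have hC := hC (a + A.size + 1 + B.size)
    rw [show a + A.size + 1 + B.size + C.size = a + (node s A B C).size by simp only [size]; lia]
      at hC
    exact (hA a).glue (by lia) (by lia) (by simp only [size]; lia) (hB _) hC

/-- A good node has its own gap or a nontrivial first or second subtree, to which induction applies.
-/
theorem gaps_nonempty {t : TernaryTree} (ht : t.IsGood) (h : t ≠ leaf) (a : ℕ) :
    (t.gaps a).Nonempty := by
  induction t generalizing a with
  | leaf => exact absurd rfl h
  | node s A B C hA hB hC =>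
    rcases ht.2.2.2 with h | h | h
    · exact ⟨_, Or.inr ⟨h, rfl⟩⟩
    · obtain ⟨i, hi⟩ := hA ht.1 h a
      exact ⟨i, Or.inl (Or.inl (Or.inl hi))⟩
    · obtain ⟨i, hi⟩ := hB ht.2.1 h (a + A.size + 1)
      exact ⟨i, Or.inl (Or.inl (Or.inr hi))⟩

theorem isLevelFree {t : TernaryTree} (ht : t.IsGood) (a : ℕ) :
    (t.graph a).IsLevelFree (t.gaps a) a (a + t.size) := by
  refine ⟨isTreeOn_graph t a, fun i => mem_Ico_of_mem_gaps, ?_⟩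
  induction t generalizing a with
  | leaf => exact fun x y _ h => h.elim
  | node s A B C hA hB hC =>
    intro x y hxy h
    rcases (SimpleGraph.glue_adj (by lia)).1 h with h | h | h | h
    · obtain ⟨i, hi, h'⟩ := hA ht.1 _ hxy h
      exact ⟨i, Or.inl (Or.inl (Or.inl hi)), h'⟩
    · obtain ⟨i, hi, h'⟩ := hB ht.2.1 _ hxy h
      exact ⟨i, Or.inl (Or.inl (Or.inr hi)), h'⟩
    · obtain ⟨i, hi, h'⟩ := hC ht.2.2.1 _ hxy h
      exact ⟨i, Or.inl (Or.inr hi), h'⟩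
    · rcases ht.2.2.2 with hs | hs | hs
      · exact ⟨_, Or.inr ⟨hs, rfl⟩, by lia⟩
      · obtain ⟨i, hi⟩ := gaps_nonempty ht.1 hs a
        have := mem_Ico_of_mem_gaps hi
        exact ⟨i, Or.inl (Or.inl (Or.inl hi)), by lia⟩
      · obtain ⟨i, hi⟩ := gaps_nonempty ht.2.1 hs (a + A.size + 1)
        have := mem_Ico_of_mem_gaps hi
        exact ⟨i, Or.inl (Or.inl (Or.inr hi)), by lia⟩

/-- The four sources of gaps occupy disjoint ranges, so the union determines each of them. -/
theorem gaps_node (s : Bool) (A B C : TernaryTree) (a : ℕ) :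
    A.gaps a = {i ∈ (node s A B C).gaps a | i < a + A.size} ∧
    B.gaps (a + A.size + 1) =
      {i ∈ (node s A B C).gaps a | a + A.size < i ∧ i < a + A.size + 1 + B.size} ∧
    C.gaps (a + A.size + 1 + B.size) =
      {i ∈ (node s A B C).gaps a | a + A.size + 1 + B.size ≤ i} ∧
    (s = true ↔ a + A.size ∈ (node s A B C).gaps a) := by
  have hA {i : ℕ} := mem_Ico_of_mem_gaps (t := A) (a := a) (i := i)
  have hB {i : ℕ} := mem_Ico_of_mem_gaps (t := B) (a := a + A.size + 1) (i := i)
  have hC {i : ℕ} := mem_Ico_of_mem_gaps (t := C) (a := a + A.size + 1 + B.size) (i := i)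
  have h {i : ℕ} : i ∈ (node s A B C).gaps a ↔ ((i ∈ A.gaps a ∨ i ∈ B.gaps (a + A.size + 1)) ∨
      i ∈ C.gaps (a + A.size + 1 + B.size)) ∨ (s = true ∧ i = a + A.size) := Iff.rfl
  refine ⟨Set.ext fun i => ?_, Set.ext fun i => ?_, Set.ext fun i => ?_, ?_⟩
  iterate 3
    have := @hA i; have := @hB i; have := @hC i; have := @h i
    simp only [Set.mem_sep_iff]
    grind
  · have := @hA (a + A.size); have := @hB (a + A.size); have := @hC (a + A.size)
    have := @h (a + A.size); grind

theorem ext_of_graph_gaps {t t' : TernaryTree} {a : ℕ} (hs : t.size = t'.size)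
    (hg : t.graph a = t'.graph a) (hL : t.gaps a = t'.gaps a) : t = t' := by
  induction t generalizing t' a with
  | leaf => exact (size_eq_zero.1 hs.symm).symm
  | node s A B C hA hB hC =>
    rcases t' with _ | ⟨s', A', B', C'⟩
    · simp [size] at hs
    simp only [size] at hs
    have tC := isTreeOn_graph C (a + A.size + 1 + B.size)
    have tC' := isTreeOn_graph C' (a + A'.size + 1 + B'.size)
    rw [show a + A'.size + 1 + B'.size + C'.size = a + A.size + 1 + B.size + C.size by lia] at tC'
    obtain ⟨h1, h2, h3, h4, h5⟩ := SimpleGraph.glue_inj (by lia) (by lia) (by lia) (by lia)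
      (isTreeOn_graph A a) (isTreeOn_graph B _) tC (isTreeOn_graph A' a) (isTreeOn_graph B' _) tC' hg
    have e1 : A.size = A'.size := by lia
    have e2 : B.size = B'.size := by lia
    have e3 : C.size = C'.size := by lia
    obtain ⟨g1, g2, g3, g4⟩ := gaps_node s A B C a
    obtain ⟨g1', g2', g3', g4'⟩ := gaps_node s' A' B' C' a
    rw [← e1, ← hL] at g1' g4'
    rw [← e1, ← e2, ← hL] at g2' g3'
    rw [← e1] at h4
    rw [← e1, ← e2] at h5
    obtain rfl := hA e1 h3 (g1.trans g1'.symm)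
    obtain rfl := hB e2 h4 (g2.trans g2'.symm)
    obtain rfl := hC e3 h5 (g3.trans g3'.symm)
    rw [Bool.eq_iff_iff.2 (g4.trans g4'.symm)]

/-- Strong induction along `exists_glue`: `L` is cut at `k` and `m`, and the gap `k`, lying in no
piece, becomes the Boolean. -/
theorem exists_of_isLevelFree {n a : ℕ} {G : SimpleGraph ℕ} {L : Set ℕ}
    (h : G.IsLevelFree L a (a + n)) :
    ∃ t : TernaryTree, t.IsGood ∧ t.size = n ∧ t.graph a = G ∧ t.gaps a = L := by
  induction n using Nat.strong_induction_on generalizing a G L with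
  | _ n ih =>
    rcases Nat.eq_zero_or_pos n with rfl | hn
    · refine ⟨leaf, trivial, rfl, ?_, ?_⟩
      · ext x y
        refine ⟨fun h => h.elim, fun hxy => ?_⟩
        have h1 := h.isTreeOn.supported hxy
        have h2 := h.isTreeOn.supported hxy.symm
        exact absurd (by lia : x = y) hxy.ne
      · ext i
        refine ⟨fun h => h.elim, fun hi => ?_⟩
        have := h.mem_Ico i hi
        lia
    obtain ⟨k, m, A, B, C, hak, hkm, hmb, hA, hB, hC, rfl⟩ := h.isTreeOn.exists_glue (by lia)
    have am : a < m := by lia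
    have gap := h.exists_gap
    have lA : A.IsLevelFree {i ∈ L | i < k} a (a + (k - a)) := by
      rw [show a + (k - a) = k by lia]
      refine ⟨hA, fun i hi => ⟨(h.mem_Ico i hi.1).1, hi.2⟩, fun x y hxy hadj => ?_⟩
      obtain ⟨i, hi, h1⟩ := gap hxy ((SimpleGraph.glue_adj am).2 (Or.inl hadj))
      have := hA.supported hadj.symm
      exact ⟨i, ⟨hi, by lia⟩, h1⟩
    have lB : B.IsLevelFree {i ∈ L | k < i ∧ i < m} (k + 1) (k + 1 + (m - (k + 1))) := by
      rw [show k + 1 + (m - (k + 1)) = m by lia]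
      refine ⟨hB, fun i hi => hi.2, fun x y hxy hadj => ?_⟩
      obtain ⟨i, hi, h1⟩ := gap hxy ((SimpleGraph.glue_adj am).2 (Or.inr (Or.inl hadj)))
      have := hB.supported hadj.symm
      have := hB.supported hadj
      exact ⟨i, ⟨hi, by lia⟩, h1⟩
    have lC : C.IsLevelFree {i ∈ L | m ≤ i} m (m + (a + n - m)) := by
      rw [show m + (a + n - m) = a + n by lia]
      refine ⟨hC, fun i hi => ⟨hi.2, (h.mem_Ico i hi.1).2⟩, fun x y hxy hadj => ?_⟩
      obtain ⟨i, hi, h1⟩ := gap hxy ((SimpleGraph.glue_adj am).2 (Or.inr (Or.inr (Or.inl hadj))))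
      have := hC.supported hadj
      exact ⟨i, ⟨hi, by lia⟩, h1⟩
    obtain ⟨tA, gA, sA, rfl, eA⟩ := ih _ (by lia) lA
    obtain ⟨tB, gB, sB, rfl, eB⟩ := ih _ (by lia) lB
    obtain ⟨tC, gC, sC, rfl, eC⟩ := ih _ (by lia) lC
    classical
    have hk : a + tA.size = k := by lia
    have hm : k + 1 + tB.size = m := by lia
    refine ⟨node (decide (k ∈ L)) tA tB tC, ⟨gA, gB, gC, ?_⟩, by simp only [size]; lia, ?_, ?_⟩
    -- At a bad node `m = a + 1`, so `k` is the only gap under `am`, yet `k ∉ L`.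
    · by_contra hcon
      push Not at hcon
      obtain ⟨h1, rfl, rfl⟩ := hcon
      simp only [size] at hk hm
      obtain ⟨i, hi, h2⟩ := gap am ((SimpleGraph.glue_adj am).2 (by simp))
      obtain rfl : i = k := by lia
      simp [hi] at h1
    · simp only [graph, hk, hm]
    · simp only [gaps, hk, hm, eA, eB, eC]
      ext i
      simp only [Set.mem_union, Set.mem_ofPred_eq, decide_eq_true_eq]
      have : i = k → (k ∈ L ↔ i ∈ L) := by rintro rfl; rfl
      grind

end TernaryTree

/-! ### GNC-trees as non-crossing trees with gap sets. -/

namespace GNCTree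

variable {n : ℕ}

/-- In a tree every edge is the last edge of the path from the root to one of its ends, so avoidance
is a condition on single edges. -/
theorem mem_avoiding_h_iff {T : GNCTree n} :
    T ∈ avoiding n {[EdgeKind.h]} ↔ ∀ ⦃v w⦄, T.graph.Adj v w → T.label v ≠ T.label w := by
  have kind (v w : Fin (n + 1)) : T.edgeKind v w = EdgeKind.h ↔ T.label v = T.label w := by
    unfold edgeKind
    split_ifs <;> simp <;> lia
  have cont : T.Contains [EdgeKind.h] ↔ ∃ (v : Fin (n + 1)) (p : T.graph.Walk 0 v), p.IsPath ∧
      ∃ e ∈ p.darts, T.label e.fst = T.label e.snd := by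
    simp only [Contains, List.singleton_infix_iff, word, List.mem_map, kind]
  have hmem : T ∈ avoiding n {[EdgeKind.h]} ↔ ¬ T.Contains [EdgeKind.h] := by
    simp [avoiding, Avoids]
  rw [hmem, cont]
  constructor
  · intro h v w hvw he
    obtain ⟨p, hp, -⟩ := T.isTree.existsUnique_path 0 v
    obtain ⟨q, hq, -⟩ := T.isTree.existsUnique_path 0 w
    have hac := T.isTree.isAcyclic
    by_cases hv : v ∈ q.support
    · refine h ⟨w, q, hq, ⟨(v, w), hvw⟩, ?_, he⟩
      rw [hac.path_concat hp hq hvw hv, SimpleGraph.Walk.darts_concat]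
      simp
    · have hw := hac.mem_support_of_ne_mem_support_of_adj_of_isPath hp hq hvw hv
      refine h ⟨v, p, hp, ⟨(w, v), hvw.symm⟩, ?_, he.symm⟩
      rw [hac.path_concat hq hp hvw.symm hw, SimpleGraph.Walk.darts_concat]
      simp
  · rintro h ⟨v, p, -, e, -, he⟩
    exact h e.adj he

/-- The graph of a GNC-tree, on the natural numbers. -/
def natGraph (T : GNCTree n) : SimpleGraph ℕ := T.graph.map Fin.valEmbedding

/-- The gaps at which the label increases. -/
def gapSet (T : GNCTree n) : Set ℕ :=
  {i | ∃ h : i + 1 < n + 1, T.label ⟨i, by lia⟩ < T.label ⟨i + 1, h⟩}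

theorem natGraph_adj (T : GNCTree n) {v w : Fin (n + 1)} :
    T.natGraph.Adj v w ↔ T.graph.Adj v w :=
  SimpleGraph.map_adj_apply (f := Fin.valEmbedding)

theorem exists_of_natGraph_adj {T : GNCTree n} {x y : ℕ} (h : T.natGraph.Adj x y) :
    ∃ v w : Fin (n + 1), (v : ℕ) = x ∧ (w : ℕ) = y ∧ T.graph.Adj v w := by
  obtain ⟨v, w, hvw, rfl, rfl⟩ := (SimpleGraph.map_adj _ _ _ _).1 h
  exact ⟨v, w, rfl, rfl, hvw⟩

theorem supportedOn_natGraph (T : GNCTree n) : T.natGraph.SupportedOn 0 (0 + n) := by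
  intro x y h
  obtain ⟨v, w, rfl, rfl, -⟩ := exists_of_natGraph_adj h
  lia

theorem window_natGraph (T : GNCTree n) : T.natGraph.window 0 n = T.graph := by
  ext v w
  change T.natGraph.Adj (0 + v) (0 + w) ↔ _
  rw [zero_add, zero_add, natGraph_adj]

theorem isTreeOn_natGraph (T : GNCTree n) : T.natGraph.IsTreeOn 0 (0 + n) := by
  obtain ⟨h1, h2⟩ := T.supportedOn_natGraph.isTree_window_iff.1 (T.window_natGraph ▸ T.isTree)
  refine ⟨T.supportedOn_natGraph, ?_, h1, by simpa using h2⟩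
  intro p q r s h1 h2 h3 h4 h5
  obtain ⟨v, w, rfl, rfl, h⟩ := exists_of_natGraph_adj h4
  obtain ⟨v', w', rfl, rfl, h'⟩ := exists_of_natGraph_adj h5
  exact T.nonCrossing v v' w w' h1 h2 h3 h h'

open scoped Classical in
-- Labels start at `1` and rise by at most one at each gap, so the gap set determines them.
theorem label_eq (T : GNCTree n) (v : Fin (n + 1)) : T.label v = 1 + Nat.count (· ∈ T.gapSet) v := by
  obtain ⟨v, hv⟩ := v
  induction v with
  | zero =>
    obtain ⟨w, hw⟩ := T.label_initial ⟨0, hv⟩ 1 le_rfl (T.one_le_label _)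
    have h1 : T.label ⟨0, hv⟩ ≤ T.label w := T.label_mono (Fin.le_def.2 (Nat.zero_le _))
    have h2 := T.one_le_label ⟨0, hv⟩
    simp only [Nat.count_zero]
    lia
  | succ v ih =>
    have ih := ih (by lia)
    simp only at ih
    rw [Nat.count_succ]
    have h1 : T.label ⟨v, by lia⟩ ≤ T.label ⟨v + 1, hv⟩ := T.label_mono (by simp)
    -- A larger jump would skip a value that, by monotonicity, no other point can take.
    have h2 : T.label ⟨v + 1, hv⟩ ≤ T.label ⟨v, by lia⟩ + 1 := by
      by_contra hlt
      obtain ⟨w, hw⟩ := T.label_initial ⟨v + 1, hv⟩ (T.label ⟨v, by lia⟩ + 1) (by lia) (by lia)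
      rcases Nat.lt_or_ge v w with h | h
      · have : T.label ⟨v + 1, hv⟩ ≤ T.label w := T.label_mono (Fin.le_def.2 h)
        lia
      · have : T.label w ≤ T.label ⟨v, by lia⟩ := T.label_mono (Fin.le_def.2 h)
        lia
    have h3 : v ∈ T.gapSet ↔ T.label ⟨v, by lia⟩ < T.label ⟨v + 1, hv⟩ :=
      ⟨fun ⟨_, h⟩ => h, fun h => ⟨hv, h⟩⟩
    split_ifs with h
    · have := h3.1 h
      lia
    · have := mt h3.2 h
      lia

end GNCTree

theorem Nat.count_lt_count_iff_exists {p : ℕ → Prop} [DecidablePred p] {x y : ℕ} :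
    Nat.count p x < Nat.count p y ↔ ∃ i, p i ∧ x ≤ i ∧ i < y := by
  constructor
  · intro h
    induction y with
    | zero => simp at h
    | succ y ih =>
      by_cases hy : Nat.count p x < Nat.count p y
      · obtain ⟨i, h1, h2, h3⟩ := ih hy
        exact ⟨i, h1, h2, by lia⟩
      · have hxy := Nat.lt_of_count_lt_count h
        refine ⟨y, ?_, by lia, by lia⟩
        by_contra hp
        rw [Nat.count_succ, if_neg hp] at h
        lia
  · rintro ⟨i, h1, h2, h3⟩
    exact (Nat.count_monotone p h2).trans_lt (Nat.count_strict_mono h1 h3)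

theorem Nat.exists_count_eq {p : ℕ → Prop} [DecidablePred p] {y i : ℕ} (h : i ≤ Nat.count p y) :
    ∃ x ≤ y, Nat.count p x = i := by
  induction y with
  | zero => exact ⟨0, le_rfl, by simpa [eq_comm] using h⟩
  | succ y ih =>
    by_cases hi : i ≤ Nat.count p y
    · obtain ⟨x, h1, h2⟩ := ih hi
      exact ⟨x, by lia, h2⟩
    · refine ⟨y + 1, le_rfl, ?_⟩
      rw [Nat.count_succ] at h ⊢
      split_ifs at h ⊢ <;> lia

namespace GNCTree

variable {n : ℕ}

open scoped Classical in
theorem label_lt_iff (T : GNCTree n) {v w : Fin (n + 1)} :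
    T.label v < T.label w ↔ ∃ i ∈ T.gapSet, (v : ℕ) ≤ i ∧ i < w := by
  rw [label_eq, label_eq, Nat.add_lt_add_iff_left, Nat.count_lt_count_iff_exists]

theorem isLevelFree (T : GNCTree n) (hT : T ∈ avoiding n {[EdgeKind.h]}) :
    T.natGraph.IsLevelFree T.gapSet 0 (0 + n) := by
  refine ⟨T.isTreeOn_natGraph, fun i ⟨h, _⟩ => by lia, fun x y hxy h => ?_⟩
  obtain ⟨v, w, rfl, rfl, hvw⟩ := exists_of_natGraph_adj h
  exact T.label_lt_iff.1 (lt_of_le_of_ne (T.label_mono (Fin.le_def.2 hxy.le))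
    (mem_avoiding_h_iff.1 hT hvw))

theorem ext_of_natGraph_gapSet {T T' : GNCTree n} (h1 : T.natGraph = T'.natGraph)
    (h2 : T.gapSet = T'.gapSet) : T = T' := by
  refine GNCTree.ext ?_ (funext fun v => ?_)
  · rw [← T.window_natGraph, h1, T'.window_natGraph]
  · rw [label_eq, label_eq, h2]

open scoped Classical in
theorem exists_of_isLevelFree {G : SimpleGraph ℕ} {L : Set ℕ} (h : G.IsLevelFree L 0 (0 + n)) :
    ∃ T ∈ avoiding n {[EdgeKind.h]}, T.natGraph = G ∧ T.gapSet = L := by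
  have hG := h.isTreeOn
  have adj {v w : Fin (n + 1)} : (G.window 0 n).Adj v w ↔ G.Adj v w := by
    change G.Adj (0 + v) (0 + w) ↔ _
    rw [zero_add, zero_add]
  let T : GNCTree n :=
    { graph := G.window 0 n
      isTree := hG.supported.isTree_window_iff.2
        ⟨hG.connected, by simpa using hG.encard_edgeSet⟩
      nonCrossing := fun a b c d h1 h2 h3 h4 h5 =>
        hG.nonCrossing h1 h2 h3 (adj.1 h4) (adj.1 h5)
      label := fun v => 1 + Nat.count (· ∈ L) v
      one_le_label := fun v => Nat.le_add_right _ _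
      label_mono := fun v w hvw => Nat.add_le_add_left (Nat.count_monotone _ hvw) 1
      label_initial := fun v i h1 h2 => by
        -- A count grows by at most one per step, so it takes every intermediate value; `i - 1`
        -- offsets the initial label `1`.
        obtain ⟨x, hx, h3⟩ := Nat.exists_count_eq (show i - 1 ≤ Nat.count (· ∈ L) v by lia)
        exact ⟨⟨x, by lia⟩, by simp only [h3]; lia⟩ }
  refine ⟨T, mem_avoiding_h_iff.2 ?_, ?_, ?_⟩
  · have key {v w : Fin (n + 1)} (hvw : v < w) (ha : T.graph.Adj v w) : T.label v < T.label w :=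
      Nat.add_lt_add_left (Nat.count_lt_count_iff_exists.2 (h.exists_gap hvw (adj.1 ha))) 1
    intro v w ha
    rcases lt_or_gt_of_ne ha.ne with hvw | hvw
    · exact (key hvw ha).ne
    · exact (key hvw ha.symm).ne'
  · ext x y
    constructor
    · intro hxy
      obtain ⟨v, w, rfl, rfl, hvw⟩ := exists_of_natGraph_adj hxy
      exact adj.1 hvw
    · intro hxy
      have h1 := hG.supported hxy
      have h2 := hG.supported hxy.symm
      exact (T.natGraph_adj (v := ⟨x, by lia⟩) (w := ⟨y, by lia⟩)).2 (adj.2 hxy)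
  · have key (i : ℕ) : 1 + Nat.count (· ∈ L) i < 1 + Nat.count (· ∈ L) (i + 1) ↔ i ∈ L := by
      rw [Nat.add_lt_add_iff_left, Nat.count_lt_count_succ_iff]
    ext i
    refine ⟨fun ⟨_, hi⟩ => (key i).1 hi, fun hi => ?_⟩
    have := h.mem_Ico i hi
    exact ⟨by lia, (key i).2 hi⟩

/-! ### Two bijections onto the same set of level-free pairs. -/

theorem bijOn_avoiding_h (n : ℕ) : Set.BijOn (fun T : GNCTree n => (T.natGraph, T.gapSet))
    (avoiding n {[EdgeKind.h]})
    {x : SimpleGraph ℕ × Set ℕ | x.1.IsLevelFree x.2 0 (0 + n)} := by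
  refine ⟨fun T hT => T.isLevelFree hT, fun T _ T' _ h => ?_, fun x hx => ?_⟩
  · exact ext_of_natGraph_gapSet (congrArg Prod.fst h) (congrArg Prod.snd h)
  · obtain ⟨T, hT, h1, h2⟩ := exists_of_isLevelFree hx
    exact ⟨T, hT, Prod.ext h1 h2⟩

end GNCTree

theorem TernaryTree.bijOn_goodFinset (n : ℕ) :
    Set.BijOn (fun t : TernaryTree => (t.graph 0, t.gaps 0)) (goodFinset n)
      {x : SimpleGraph ℕ × Set ℕ | x.1.IsLevelFree x.2 0 (0 + n)} := by
  refine ⟨fun t ht => ?_, fun t ht t' ht' h => ?_, fun x hx => ?_⟩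
  · obtain ⟨h1, rfl⟩ := mem_goodFinset.1 ht
    exact t.isLevelFree h1 0
  · have hs := (mem_goodFinset.1 ht).2.trans (mem_goodFinset.1 ht').2.symm
    exact ext_of_graph_gaps hs (congrArg Prod.fst h) (congrArg Prod.snd h)
  · obtain ⟨t, h1, h2, h3, h4⟩ := exists_of_isLevelFree hx
    exact ⟨t, mem_goodFinset.2 ⟨h1, h2⟩, Prod.ext h3 h4⟩

theorem mainTheorem3 (n : ℕ) :
    (GNCTree.avoiding n {[EdgeKind.h]}).Finite ∧
    ((GNCTree.avoiding n {[EdgeKind.h]}).ncard : ℚ) =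
      ∑ i ∈ Finset.range (n + 1),
        (-1 : ℚ) ^ (n - i) * ((2 : ℚ) ^ i / (2 * (i : ℚ) + 1)) *
          (Nat.choose (3 * i) i : ℚ) * (Nat.choose (n + 2 * i) (3 * i) : ℚ) := by
  have h1 := GNCTree.bijOn_avoiding_h n
  have h2 := TernaryTree.bijOn_goodFinset n
  refine ⟨h1.finite_iff_finite.2 (h2.finite_iff_finite.1 (Finset.finite_toSet _)), ?_⟩
  rw [h1.ncard_eq, ← h2.ncard_eq, Set.ncard_coe_finset, TernaryTree.card_goodFinset]
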